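/- Let $q$ be a prime power and let $\mathrm{PG}(N-1,q)$ be the $(N-1)$-dimensional projective space over the field with $q$ elements; a $d$-space is a subspace of projective dimension $d$. For $r\le k\le N$, let $\mathcal C_q(N,k,r)$ be the minimum cardinality of a $q$-covering design $\mathbb C_q(N,k,r)$, i.e. of a set $\mathcal X$ of $(k-1)$-spaces of $\mathrm{PG}(N-1,q)$ such that every $(r-1)$-space of $\mathrm{PG}(N-1,q)$ is contained in at least one element of $\mathcal X$. Write $\theta_{m,x}=x^m+\dots+x+1$. Then, for every integer $n\ge 0$, $$\left\lceil \frac{\theta_{3n+7,q}\,\theta_{3n+6,q}}{(q+1)(q^2+1)(q^2+q+1)} \right\rceil \le \mathcal C_q(3n+8,4,2)$$ and $$\mathcal C_q(3n+8,4,2) \le q^{3n+5}\,\theta_{n+1,q^3}+\sum_{i=0}^{n-1}\left(\theta_{6i+10,q}-\theta_{3i+4,q}\right)+\sum_{i=0}^{n}q^{3i+2}(2q^2-1)+q(q+1)(2q+1),$$ where the sum over $0\le i\le n-1$ is empty for $n=0$. -/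

import Mathlib

namespace QCovering

/-- `theta m x = x ^ m + ... + x + 1`; for a prime power `x` this is the number of points of
the `m`-dimensional projective space over the field with `x` elements. -/
def theta (m x : ℕ) : ℕ := ∑ i ∈ Finset.range (m + 1), x ^ i

/-- A `q`-covering design with parameters `(n, k, r)` over the field `K` with `q` elements:
a collection `X` of `(k - 1)`-spaces of `PG(n - 1, q)` such that every `(r - 1)`-space of
`PG(n - 1, q)` is contained in at least one element of `X`.  A projective `(d - 1)`-space of
`PG(n - 1, q)` is a `d`-dimensional linear subspace of `K ^ n`. -/
def IsDesign (K : Type*) [Field K] (n k r : ℕ) (X : Finset (Submodule K (Fin n → K))) : Prop :=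
  (∀ U ∈ X, Module.finrank K U = k) ∧
    ∀ W : Submodule K (Fin n → K), Module.finrank K W = r → ∃ U ∈ X, W ≤ U

/-- The minimum number of `(k - 1)`-spaces in a `q`-covering design with parameters
`(n, k, r)`. -/
noncomputable def coveringNumber (K : Type*) [Field K] (n k r : ℕ) : ℕ :=
  sInf {m : ℕ | ∃ X : Finset (Submodule K (Fin n → K)), IsDesign K n k r X ∧ X.card = m}

/-- For `r ≤ k ≤ n` over a finite field, designs exist, so that `coveringNumber` is a true
minimum and not the default value of `sInf` at the empty set. -/
theorem coveringNumber_isLeast (K : Type*) [Field K] [Finite K] {n k r : ℕ}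
    (hrk : r ≤ k) (hkn : k ≤ n) :
    IsLeast {m : ℕ | ∃ X : Finset (Submodule K (Fin n → K)), IsDesign K n k r X ∧ X.card = m}
      (coveringNumber K n k r) := by
  have key : ∀ d : ℕ, ∀ W : Submodule K (Fin n → K), Module.finrank K W + d ≤ n →
      ∃ U : Submodule K (Fin n → K), W ≤ U ∧ Module.finrank K U = Module.finrank K W + d := by
    intro d
    induction d with
    | zero => exact fun W _ => ⟨W, le_refl W, rfl⟩
    | succ d ih =>
      intro W hW
      obtain ⟨U, hWU, hU⟩ := ih W (by omega)
      have hlt : Module.finrank K U < Module.finrank K (Fin n → K) := by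
        rw [Module.finrank_fin_fun]; omega
      have hne : U ≠ ⊤ := by
        rintro rfl
        simp at hlt
      obtain ⟨v, -, hv⟩ := SetLike.exists_of_lt (lt_top_iff_ne_top.mpr hne)
      refine ⟨U ⊔ K ∙ v, hWU.trans le_sup_left, ?_⟩
      have hv0 : v ≠ 0 := fun h => hv (h ▸ U.zero_mem)
      have hdis : U ⊓ K ∙ v = ⊥ := by
        rw [← disjoint_iff]
        exact (Submodule.disjoint_span_singleton' hv0).mpr hv
      have := Submodule.finrank_sup_add_finrank_inf_eq U (K ∙ v)
      rw [hdis, finrank_bot, finrank_span_singleton hv0] at this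
      omega
  have hne : {m : ℕ | ∃ X : Finset (Submodule K (Fin n → K)),
      IsDesign K n k r X ∧ X.card = m}.Nonempty := by
    classical
    have : Finite (Submodule K (Fin n → K)) :=
      Finite.of_injective _ (SetLike.coe_injective (A := Submodule K (Fin n → K)))
    have hfin := Set.toFinite {U : Submodule K (Fin n → K) | Module.finrank K U = k}
    refine ⟨_, hfin.toFinset, ⟨fun U hU => by simpa using hU, fun W hW => ?_⟩, rfl⟩
    obtain ⟨U, hWU, hU⟩ := key (k - r) W (by omega)
    exact ⟨U, by simp; omega, hWU⟩
  exact ⟨Nat.sInf_mem hne, fun m hm => Nat.sInf_le hm⟩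

end QCovering

namespace QCovering

open Module

/-! Lower bound: every independent pair of vectors lies in a member of the design, so counting
ordered pairs suffices (`card_pairs_le_coveringNumber`).

Upper bound: split the space as `A × L` with `A` of dimension 4 and `L` an extension field of `K`,
and sort the 2-dimensional `W` by the dimension of `W ∩ (0 × L)`. If it is 0, `W` is the graph of a
map on a plane of `A`, and some `x ↦ aφ(x) + bφ(x)^q` interpolates it: `|L|^2` graphs suffice. If it
is 1, `W` lies in a cone joining a point outside `0 × L` to a 3-dimensional member of a point
covering of `L`. In the recursion (`coveringNumber_line_step`) one point `P₀` of `A` is set aside: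
lines over `P₀` and lines inside `0 × L` all lie in `⟨P₀⟩ × L`, three dimensions smaller than `A ×
L`. In dimension 8 (`coveringNumber_line_eight`) the point coverings are chosen so that the cones
also absorb the lines inside `0 × L`. -/

theorem coveringNumber_le_card {K V ι : Type*} [Field K] [AddCommGroup V] [Module K V]
    [FiniteDimensional K V] [Finite ι] {N k r : ℕ} (hV : finrank K V = N)
    (U : ι → Submodule K V) (hU : ∀ i, finrank K (U i) = k)
    (hc : ∀ W : Submodule K V, finrank K W = r → ∃ i, W ≤ U i) :
    coveringNumber K N k r ≤ Nat.card ι := by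
  classical
  have := Fintype.ofFinite ι
  let e : V ≃ₗ[K] (Fin N → K) := LinearEquiv.ofFinrankEq _ _ (by simpa)
  let X : Finset (Submodule K (Fin N → K)) :=
    Finset.univ.image fun i => (U i).map (e : V →ₗ[K] (Fin N → K))
  have hX : IsDesign K N k r X := by
    refine ⟨fun T hT => ?_, fun W hW => ?_⟩
    · obtain ⟨i, -, rfl⟩ := Finset.mem_image.1 hT
      rw [← hU i]
      exact LinearEquiv.finrank_map_eq e (U i)
    · obtain ⟨i, hi⟩ := hc (W.map (e.symm : (Fin N → K) →ₗ[K] V))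
        ((LinearEquiv.finrank_map_eq e.symm W).trans hW)
      refine ⟨_, Finset.mem_image_of_mem _ (Finset.mem_univ i), fun w hw => ?_⟩
      exact ⟨e.symm w, hi ⟨w, hw, rfl⟩, by simp⟩
  calc coveringNumber K N k r ≤ X.card := Nat.sInf_le ⟨X, hX, rfl⟩
    _ ≤ Fintype.card ι := Finset.card_image_le
    _ = Nat.card ι := Fintype.card_eq_nat_card

theorem exists_family_coveringNumber {K V : Type*} [Field K] [Finite K] [AddCommGroup V]
    [Module K V] [FiniteDimensional K V] {N k r : ℕ} (hrk : r ≤ k) (hkN : k ≤ N)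
    (hV : finrank K V = N) :
    ∃ U : Fin (coveringNumber K N k r) → Submodule K V, (∀ i, finrank K (U i) = k) ∧
      ∀ W : Submodule K V, finrank K W = r → ∃ i, W ≤ U i := by
  obtain ⟨X, ⟨hX, hXc⟩, hcard⟩ := (coveringNumber_isLeast K hrk hkN).1
  let e : V ≃ₗ[K] (Fin N → K) := LinearEquiv.ofFinrankEq _ _ (by simpa)
  let f : Fin (coveringNumber K N k r) ≃ X := (finCongr hcard.symm).trans X.equivFin.symm
  refine ⟨fun i => (f i : Submodule K (Fin N → K)).map (e.symm : (Fin N → K) →ₗ[K] V),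
    fun i => ?_, fun W hW => ?_⟩
  · exact (LinearEquiv.finrank_map_eq e.symm _).trans (hX _ (f i).2)
  · obtain ⟨T, hT, hWT⟩ := hXc (W.map (e : V →ₗ[K] (Fin N → K)))
      ((LinearEquiv.finrank_map_eq e W).trans hW)
    refine ⟨f.symm ⟨T, hT⟩, fun w hw => ?_⟩
    exact ⟨e w, by simpa using hWT ⟨w, hw, rfl⟩, by simp⟩

/-! ### Field extensions and Gabidulin graphs. -/

theorem finrank_graph {K A B : Type*} [Field K] [AddCommGroup A] [Module K A]
    [AddCommGroup B] [Module K B] (f : A →ₗ[K] B) : finrank K f.graph = finrank K A := by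
  rw [LinearMap.graph_eq_range_prod]
  exact LinearMap.finrank_range_of_inj fun x y h => congrArg Prod.fst h

theorem exists_extension_finrank (K : Type*) [Field K] [Finite K] (s : ℕ) (hs : s ≠ 0) :
    ∃ (L : Type) (_ : Field L) (_ : Algebra K L), Finite L ∧ finrank K L = s := by
  obtain ⟨p, hp⟩ := CharP.exists K
  have : Fact p.Prime := ⟨CharP.char_is_prime K p⟩
  have : NeZero s := ⟨hs⟩
  exact ⟨FiniteField.Extension K p s, inferInstance, inferInstance, inferInstance,
    FiniteField.finrank_extension K p s⟩

/-- `X^q - X` has at most `q` roots, and the image of `K` already supplies `q` of them. -/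
theorem mem_range_algebraMap_of_pow_card_eq {K L : Type*} [Field K] [Fintype K] [Field L]
    [Algebra K L] {x : L} (hx : x ^ Fintype.card K = x) : ∃ c : K, algebraMap K L c = x := by
  classical
  have h := FiniteField.X_pow_card_sub_X_ne_zero L (Fintype.one_lt_card (α := K))
  have hs : Finset.univ.image (algebraMap K L) ⊆
      (Polynomial.X ^ Fintype.card K - Polynomial.X : Polynomial L).roots.toFinset := by
    intro y hy
    obtain ⟨c, -, rfl⟩ := Finset.mem_image.1 hy
    simp [h, ← map_pow, FiniteField.pow_card]
  have hcard := Finset.eq_of_subset_of_card_le hs (by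
    rw [Finset.card_image_of_injective _ (algebraMap K L).injective, Finset.card_univ]
    refine (Multiset.toFinset_card_le _).trans ((Polynomial.card_roots' _).trans ?_)
    rw [FiniteField.X_pow_card_sub_X_natDegree_eq L Fintype.one_lt_card])
  have hx' : x ∈ Finset.univ.image (algebraMap K L) := by
    rw [hcard]
    simp [h, hx]
  simpa using hx'

/-- This is a 2 by 2 Moore determinant: if it vanished, `y / x` would be fixed by Frobenius, hence a
scalar of `K`. -/
theorem mul_pow_card_sub_ne_zero {K L : Type*} [Field K] [Fintype K] [Field L] [Algebra K L]
    {x y : L} (h : LinearIndependent K ![x, y]) :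
    x * y ^ Fintype.card K - y * x ^ Fintype.card K ≠ 0 := by
  intro h0
  have hx : x ≠ 0 := h.ne_zero 0
  obtain ⟨c, hc⟩ := mem_range_algebraMap_of_pow_card_eq (K := K) (x := y / x) (by
    rw [div_pow, div_eq_div_iff (pow_ne_zero _ hx) hx]
    linear_combination h0)
  rw [LinearIndependent.pair_iff] at h
  have := h c (-1) (by
    rw [Algebra.smul_def, hc]
    field_simp
    simp)
  simp at this

/-- The maps `x ↦ a φ(x) + b φ(x) ^ q` underlying a Gabidulin code. -/
noncomputable def gabidulin {K A L : Type*} [Field K] [Fintype K] [AddCommGroup A] [Module K A]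
    [Field L] [Algebra K L] (φ : A →ₗ[K] L) (a b : L) : A →ₗ[K] L :=
  (LinearMap.mulLeft K a + LinearMap.mulLeft K b ∘ₗ
    (FiniteField.frobeniusAlgHom K L).toLinearMap) ∘ₗ φ

theorem exists_gabidulin_eq {K A L : Type*} [Field K] [Fintype K] [AddCommGroup A] [Module K A]
    [Field L] [Algebra K L] {φ : A →ₗ[K] L} (hφ : Function.Injective φ) {x y : A}
    (h : LinearIndependent K ![x, y]) (u v : L) :
    ∃ a b, gabidulin φ a b x = u ∧ gabidulin φ a b y = v := by
  have h' : LinearIndependent K ![φ x, φ y] := by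
    have heq : φ ∘ ![x, y] = ![φ x, φ y] := by ext i; fin_cases i <;> rfl
    exact heq ▸ h.map' φ (LinearMap.ker_eq_bot.2 hφ)
  have hd := mul_pow_card_sub_ne_zero h'
  set X := φ x
  set Y := φ y
  set q := Fintype.card K
  -- Cramer's rule for `aX + bX^q = u`, `aY + bY^q = v`.
  refine ⟨(u * Y ^ q - v * X ^ q) / (X * Y ^ q - Y * X ^ q),
    (X * v - Y * u) / (X * Y ^ q - Y * X ^ q), ?_, ?_⟩
  · change _ * X + _ * X ^ q = u
    rw [div_mul_eq_mul_div, div_mul_eq_mul_div, ← add_div, div_eq_iff hd]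
    ring
  · change _ * Y + _ * Y ^ q = v
    rw [div_mul_eq_mul_div, div_mul_eq_mul_div, ← add_div, div_eq_iff hd]
    ring

/-- Since `W` meets `0 × L` trivially, the first coordinates of a basis of `W` stay independent, so
the second coordinates can be interpolated. -/
theorem exists_le_graph_gabidulin {K A L : Type*} [Field K] [Fintype K] [AddCommGroup A]
    [Module K A] [Field L] [Algebra K L] {φ : A →ₗ[K] L} (hφ : Function.Injective φ)
    {W : Submodule K (A × L)} (hW : finrank K W = 2) (h : ∀ c : L, (0, c) ∈ W → c = 0) :
    ∃ a b, W ≤ (gabidulin φ a b).graph := by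
  have : FiniteDimensional K W := FiniteDimensional.of_finrank_pos (by omega)
  let e := finBasisOfFinrankEq K W hW
  let f : W →ₗ[K] A := LinearMap.fst K A L ∘ₗ W.subtype
  have hf : LinearMap.ker f = ⊥ := by
    refine LinearMap.ker_eq_bot'.2 fun w hw => ?_
    have hw1 : (w : A × L).1 = 0 := hw
    have hw2 : (w : A × L).2 = 0 := h _ (by rw [← hw1]; exact w.2)
    exact Subtype.ext (Prod.ext hw1 hw2)
  have hli : LinearIndependent K ![(e 0 : A × L).1, (e 1 : A × L).1] := by
    have heq : f ∘ e = ![(e 0 : A × L).1, (e 1 : A × L).1] := by ext i; fin_cases i <;> rfl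
    exact heq ▸ e.linearIndependent.map' f hf
  obtain ⟨a, b, h0, h1⟩ := exists_gabidulin_eq hφ hli (e 0 : A × L).2 (e 1 : A × L).2
  refine ⟨a, b, ?_⟩
  have htop : (⊤ : Submodule K W) ≤ (gabidulin φ a b).graph.comap W.subtype := by
    rw [← e.span_eq, Submodule.span_le]
    rintro _ ⟨i, rfl⟩
    fin_cases i
    · simpa [LinearMap.mem_graph_iff] using h0.symm
    · simpa [LinearMap.mem_graph_iff] using h1.symm
  intro w hw
  exact htop (x := ⟨w, hw⟩) trivial

/-! ### Pencils of hyperplanes and auxiliary linear algebra. -/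

theorem finrank_sup_span_singleton {K V : Type*} [Field K] [AddCommGroup V] [Module K V]
    [FiniteDimensional K V] {S : Submodule K V} {v : V} (hv : v ∉ S) :
    finrank K (S ⊔ K ∙ v : Submodule K V) = finrank K S + 1 := by
  have hv0 : v ≠ 0 := fun h => hv (h ▸ S.zero_mem)
  have hdis : S ⊓ K ∙ v = ⊥ := by
    rw [← disjoint_iff]
    exact (Submodule.disjoint_span_singleton' hv0).mpr hv
  have := Submodule.finrank_sup_add_finrank_inf_eq S (K ∙ v)
  rw [hdis, finrank_bot, finrank_span_singleton hv0] at this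
  omega

/-- The hyperplanes through `S` are the points of the projective line of `V ⧸ S`. -/
theorem exists_pencil {K V : Type*} [Field K] [Finite K] [AddCommGroup V] [Module K V]
    [FiniteDimensional K V] {S : Submodule K V} (hS : finrank K S + 2 = finrank K V) :
    ∃ U : Fin (Nat.card K + 1) → Submodule K V, (∀ i, finrank K (U i) = finrank K S + 1) ∧
      ∀ v, ∃ i, S ⊔ K ∙ v ≤ U i := by
  have hQ : finrank K (V ⧸ S) = 2 := by
    have := S.finrank_quotient_add_finrank
    omega
  have : Nontrivial (V ⧸ S) := Module.nontrivial_of_finrank_pos (R := K) (by omega)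
  have : Finite V := Module.finite_of_finite K
  have : Finite (V ⧸ S) := Module.finite_of_finite K
  have e : Projectivization K (V ⧸ S) ≃ Fin (Nat.card K + 1) :=
    Finite.equivFinOfCardEq (Projectivization.card_of_finrank_two K (V ⧸ S) hQ)
  refine ⟨fun i => S ⊔ K ∙ (e.symm i).rep.out, fun i => finrank_sup_span_singleton fun h => ?_,
    fun v => ?_⟩
  · apply (e.symm i).rep_nonzero
    rw [← Submodule.Quotient.mk_out (e.symm i).rep]
    exact (Submodule.Quotient.mk_eq_zero S).2 h
  · by_cases hv : v ∈ S
    · refine ⟨0, sup_le le_sup_left ?_⟩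
      rw [Submodule.span_singleton_le_iff_mem]
      exact Submodule.mem_sup_left hv
    · have hv' : (Submodule.Quotient.mk v : V ⧸ S) ≠ 0 := fun h =>
        hv ((Submodule.Quotient.mk_eq_zero S).1 h)
      refine ⟨e (Projectivization.mk K _ hv'), sup_le le_sup_left ?_⟩
      rw [Submodule.span_singleton_le_iff_mem]
      beta_reduce
      rw [Equiv.symm_apply_apply]
      obtain ⟨c, hc⟩ := Projectivization.exists_smul_eq_mk_rep K _ hv'
      rw [← hc]
      set w := Quotient.out (c • (Submodule.Quotient.mk v : V ⧸ S)) with hw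
      have hwc : c • v - w ∈ S := by
        rw [← Submodule.Quotient.mk_eq_zero S, Submodule.Quotient.mk_sub, hw,
          Submodule.Quotient.mk_out]
        exact sub_self _
      have hcv : c • v ∈ S ⊔ K ∙ w := by
        rw [← sub_add_cancel (c • v) w]
        exact Submodule.add_mem_sup hwc (Submodule.mem_span_singleton_self w)
      have := Submodule.smul_mem _ ((c⁻¹ : Kˣ) : K) hcv
      simpa [Units.smul_def, smul_smul] using this

theorem exists_injective_of_finrank_le {K A B : Type*} [Field K] [AddCommGroup A] [Module K A]
    [AddCommGroup B] [Module K B] [FiniteDimensional K A] [FiniteDimensional K B]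
    (h : finrank K A ≤ finrank K B) : ∃ f : A →ₗ[K] B, Function.Injective f := by
  apply lift_rank_le_iff_exists_linearMap.1
  rw [← finrank_eq_rank, ← finrank_eq_rank, Cardinal.lift_natCast, Cardinal.lift_natCast]
  exact_mod_cast h

theorem finrank_map_of_injective {K A B : Type*} [Field K] [AddCommGroup A] [Module K A]
    [AddCommGroup B] [Module K B] {f : A →ₗ[K] B} (hf : Function.Injective f)
    (S : Submodule K A) : finrank K (S.map f) = finrank K S :=
  (Submodule.equivMapOfInjective f hf S).finrank_eq.symm

theorem exists_eq_span_singleton {K V : Type*} [Field K] [AddCommGroup V] [Module K V]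
    {W : Submodule K V} (hW : finrank K W = 1) : ∃ v, v ≠ 0 ∧ W = K ∙ v := by
  obtain ⟨⟨v, hvW⟩, h0, hv⟩ := finrank_eq_one_iff'.1 hW
  refine ⟨v, fun h => h0 (Subtype.ext h), le_antisymm (fun w hw => ?_) ?_⟩
  · obtain ⟨c, hc⟩ := hv ⟨w, hw⟩
    exact Submodule.mem_span_singleton.2 ⟨c, congrArg Subtype.val hc⟩
  · rwa [Submodule.span_singleton_le_iff_mem]

theorem exists_finrank_eq_two_mem {K V : Type*} [Field K] [AddCommGroup V] [Module K V]
    [FiniteDimensional K V] (hV : 2 ≤ finrank K V) {v : V} (hv : v ≠ 0) :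
    ∃ S : Submodule K V, finrank K S = 2 ∧ v ∈ S := by
  have h : K ∙ v ≠ ⊤ := fun h => by
    have := finrank_span_singleton (K := K) hv
    rw [h, finrank_top] at this
    omega
  obtain ⟨w, -, hw⟩ := SetLike.exists_of_lt (lt_top_iff_ne_top.mpr h)
  refine ⟨K ∙ v ⊔ K ∙ w, ?_, Submodule.mem_sup_left (Submodule.mem_span_singleton_self v)⟩
  rw [finrank_sup_span_singleton hw, finrank_span_singleton hv]

/-! ### Covering points by planes. -/

theorem coveringNumber_point_four (K : Type*) [Field K] [Finite K] :
    coveringNumber K 4 3 1 ≤ Nat.card K + 1 := by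
  obtain ⟨v, hv⟩ := exists_ne (0 : Fin 4 → K)
  obtain ⟨S, hS, -⟩ := exists_finrank_eq_two_mem (K := K) (by simp) hv
  obtain ⟨U, hU, hUc⟩ := exists_pencil (S := S) (by simp [hS])
  rw [← Nat.card_fin (Nat.card K + 1)]
  refine coveringNumber_le_card (V := Fin 4 → K) (by simp) U (by simpa [hS] using hU)
    fun W hW => ?_
  obtain ⟨w, -, rfl⟩ := exists_eq_span_singleton hW
  exact (hUc w).imp fun i => le_sup_right.trans

/-- A vector `(a, b)` of `K^3 × L` with `a ≠ 0` lies on the graph of `x ↦ cφ(x)` for `c = b / φ(a)`;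
the remaining vectors lie in `0 × L`. -/
theorem coveringNumber_point_add_three (K : Type*) [Field K] [Finite K] {s : ℕ} (hs : 3 ≤ s) :
    coveringNumber K (s + 3) 3 1 ≤ Nat.card K ^ s + coveringNumber K s 3 1 := by
  obtain ⟨L, _, _, _, hL⟩ := exists_extension_finrank K s (by omega)
  have : FiniteDimensional K L := FiniteDimensional.of_finrank_pos (by omega)
  obtain ⟨φ, hφ⟩ := exists_injective_of_finrank_le (K := K) (A := Fin 3 → K) (B := L)
    (by simp; omega)
  obtain ⟨C, hC, hCc⟩ := exists_family_coveringNumber (r := 1) (by omega) hs hL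
  have hcard : Nat.card (L ⊕ Fin (coveringNumber K s 3 1)) =
      Nat.card K ^ s + coveringNumber K s 3 1 := by
    rw [Nat.card_sum, Nat.card_fin, ← hL, Module.natCard_eq_pow_finrank (K := K) (V := L)]
  rw [← hcard]
  refine coveringNumber_le_card (V := (Fin 3 → K) × L) (by simp [hL]; omega)
    (Sum.elim (fun c => (LinearMap.mulLeft K c ∘ₗ φ).graph)
      (fun i => (C i).map (LinearMap.inr K (Fin 3 → K) L))) ?_ ?_
  · rintro (c | i)
    · exact (finrank_graph _).trans (by simp)
    · exact (finrank_map_of_injective LinearMap.inr_injective _).trans (hC i)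
  · intro W hW
    obtain ⟨⟨a, b⟩, h0, rfl⟩ := exists_eq_span_singleton hW
    simp only [Submodule.span_singleton_le_iff_mem]
    by_cases ha : a = 0
    · subst ha
      have hb : b ≠ 0 := fun h => h0 (by simp [h])
      obtain ⟨i, hi⟩ := hCc (K ∙ b) (finrank_span_singleton hb)
      exact ⟨.inr i, b, hi (Submodule.mem_span_singleton_self b), rfl⟩
    · have hφa : φ a ≠ 0 := (map_ne_zero_iff φ hφ).2 ha
      exact ⟨.inl (b / φ a), (div_mul_cancel₀ b hφa).symm⟩

theorem coveringNumber_point_le (K : Type*) [Field K] [Finite K] (n : ℕ) :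
    coveringNumber K (3 * n + 4) 3 1 ≤ Nat.card K * theta n (Nat.card K ^ 3) + 1 := by
  induction n with
  | zero => simpa [theta] using coveringNumber_point_four K
  | succ n ih =>
    have h := coveringNumber_point_add_three K (s := 3 * n + 4) (by omega)
    have ht : theta (n + 1) (Nat.card K ^ 3) = theta n (Nat.card K ^ 3) + (Nat.card K ^ 3) ^ (n + 1) :=
      Finset.sum_range_succ _ _
    rw [ht]
    calc _ ≤ _ := h
      _ ≤ Nat.card K ^ (3 * n + 4) + (Nat.card K * theta n (Nat.card K ^ 3) + 1) := by gcongr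
      _ = _ := by ring

/-! ### Covering lines by solids: graphs and cones. -/

theorem finrank_two_trichotomy {K A L : Type*} [Field K] [AddCommGroup A] [Module K A]
    [AddCommGroup L] [Module K L] [FiniteDimensional K A] [FiniteDimensional K L]
    {W : Submodule K (A × L)} (hW : finrank K W = 2) :
    (∀ c : L, (0, c) ∈ W → c = 0) ∨
      (∃ W' : Submodule K L, finrank K W' = 2 ∧ W = W'.map (LinearMap.inr K A L)) ∨
      ∃ (a : A) (b c : L), a ≠ 0 ∧ W = K ∙ (a, b) ⊔ K ∙ (0, c) := by
  by_cases h : ∀ w ∈ W, w.1 = 0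
  · have hle : W ≤ LinearMap.range (LinearMap.inr K A L) :=
      fun w hw => ⟨w.2, Prod.ext (h w hw).symm rfl⟩
    have hmap := Submodule.map_comap_eq_of_le hle
    refine .inr (.inl ⟨W.comap (LinearMap.inr K A L), ?_, hmap.symm⟩)
    rw [← finrank_map_of_injective (LinearMap.inr_injective (R := K) (M := A) (M₂ := L)), hmap, hW]
  · push Not at h
    obtain ⟨⟨a, b⟩, hab, ha⟩ := h
    by_cases h' : ∀ c : L, (0, c) ∈ W → c = 0
    · exact .inl h'
    · push Not at h'
      obtain ⟨c, hc, hc0⟩ := h'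
      refine .inr (.inr ⟨a, b, c, ha, (Submodule.eq_of_le_of_finrank_eq ?_ ?_).symm⟩)
      · rw [sup_le_iff, Submodule.span_singleton_le_iff_mem, Submodule.span_singleton_le_iff_mem]
        exact ⟨hab, hc⟩
      · have hn : ((0 : A), c) ∉ K ∙ (a, b) := by
          rw [Submodule.mem_span_singleton]
          rintro ⟨k, hk⟩
          simp only [Prod.smul_mk, Prod.mk.injEq, smul_eq_zero] at hk
          rcases hk with ⟨rfl | h0, hk⟩
          · exact hc0 (by rw [← hk, zero_smul])
          · exact ha h0
        rw [finrank_sup_span_singleton hn, finrank_span_singleton (fun h => ha (congrArg Prod.fst h)),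
          hW]

/-- The subspace of `A × L` spanned by `(a, b)` and `0 × S`. -/
def cone {K A L : Type*} [Field K] [AddCommGroup A] [Module K A]
    [AddCommGroup L] [Module K L] (S : Submodule K L) (a : A) (b : L) : Submodule K (A × L) :=
  S.map (LinearMap.inr K A L) ⊔ K ∙ (a, b)

theorem finrank_cone {K A L : Type*} [Field K] [AddCommGroup A] [Module K A]
    [AddCommGroup L] [Module K L] [FiniteDimensional K A] [FiniteDimensional K L]
    (S : Submodule K L) {a : A} (ha : a ≠ 0) (b : L) :
    finrank K (cone S a b) = finrank K S + 1 := by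
  rw [cone, finrank_sup_span_singleton, finrank_map_of_injective LinearMap.inr_injective]
  rintro ⟨x, -, hx⟩
  exact ha (congrArg Prod.fst hx).symm

/-- The cone depends on `b` only modulo `S`, so after rescaling `a` to the chosen representative of
its point, one cone per coset of `S` suffices. -/
theorem exists_le_cone {K A L : Type*} [Field K] [AddCommGroup A] [Module K A]
    [AddCommGroup L] [Module K L] {S : Submodule K L} {a : A} (ha : a ≠ 0) (b : L) {c : L}
    (hc : c ∈ S) : ∃ x : L ⧸ S, K ∙ (a, b) ⊔ K ∙ (0, c) ≤
      cone S (Projectivization.mk K a ha).rep x.out := by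
  obtain ⟨u, hu⟩ := Projectivization.exists_smul_eq_mk_rep K a ha
  refine ⟨Submodule.Quotient.mk (u • b), ?_⟩
  rw [← hu]
  set w := Quotient.out (Submodule.Quotient.mk (u • b) : L ⧸ S) with hw
  have hwb : u • b - w ∈ S := by
    rw [← Submodule.Quotient.mk_eq_zero S, Submodule.Quotient.mk_sub, hw,
      Submodule.Quotient.mk_out]
    exact sub_self _
  rw [sup_le_iff, Submodule.span_singleton_le_iff_mem, Submodule.span_singleton_le_iff_mem]
  refine ⟨?_, Submodule.mem_sup_left ⟨c, hc, rfl⟩⟩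
  have h : u • (a, b) ∈ cone S (u • a) w := by
    have : u • (a, b) = (0, u • b - w) + (u • a, w) := by ext <;> simp
    rw [this]
    exact Submodule.add_mem_sup ⟨_, hwb, rfl⟩ (Submodule.mem_span_singleton_self _)
  have := Submodule.smul_mem _ ((u⁻¹ : Kˣ) : K) h
  simpa [Units.smul_def, smul_smul] using this

theorem card_sigma_quotient {K L ι : Type*} [Field K] [Finite K] [AddCommGroup L] [Module K L]
    [FiniteDimensional K L] [Finite ι] {C : ι → Submodule K L} {d e : ℕ}
    (hC : ∀ i, finrank K (C i) = d) (hL : finrank K L = d + e) :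
    Nat.card (Σ i, L ⧸ C i) = Nat.card ι * Nat.card K ^ e := by
  have := Fintype.ofFinite ι
  have : Finite L := Module.finite_of_finite K
  have (i : ι) : Finite (L ⧸ C i) := Quotient.finite _
  have h (i : ι) : Nat.card (L ⧸ C i) = Nat.card K ^ e := by
    rw [Module.natCard_eq_pow_finrank (K := K)]
    congr 1
    have := (C i).finrank_quotient_add_finrank
    have := hC i
    omega
  rw [Nat.card_sigma, Finset.sum_congr rfl fun i _ => h i]
  simp

/-- The three terms count the graphs, the cones over the `q + q^2 + q^3` points of `A` other than
`P₀` (with `q^e` cosets per plane), and a design of `⟨P₀⟩ × L`. -/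
theorem coveringNumber_line_step (K : Type*) [Field K] [Fintype K] (e : ℕ) (he : 1 ≤ e) :
    coveringNumber K (e + 7) 4 2 ≤ (Nat.card K ^ (e + 3)) ^ 2 +
      (Nat.card K + Nat.card K ^ 2 + Nat.card K ^ 3) * coveringNumber K (e + 3) 3 1 *
        Nat.card K ^ e + coveringNumber K (e + 4) 4 2 := by
  classical
  obtain ⟨L, _, _, _, hL⟩ := exists_extension_finrank K (e + 3) (by omega)
  have : FiniteDimensional K L := FiniteDimensional.of_finrank_pos (by omega)
  set A := Fin 4 → K
  have hA : finrank K A = 4 := by simp [A]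
  obtain ⟨φ, hφ⟩ := exists_injective_of_finrank_le (K := K) (A := A) (B := L) (by omega)
  obtain ⟨C, hC, hCc⟩ := exists_family_coveringNumber (r := 1) (k := 3) (by omega) (by omega) hL
  obtain ⟨P₀⟩ : Nonempty (Projectivization K A) := inferInstance
  -- `ψ` identifies `K × L` with `⟨P₀⟩ × L`.
  let ψ : K × L →ₗ[K] A × L := (LinearMap.toSpanSingleton K A P₀.rep).prodMap LinearMap.id
  have hψ : Function.Injective ψ := by
    rintro ⟨x, y⟩ ⟨x', y'⟩ h
    obtain ⟨h1, h2⟩ := Prod.ext_iff.1 h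
    exact Prod.ext (smul_left_injective K P₀.rep_nonzero h1) h2
  obtain ⟨D, hD, hDc⟩ := exists_family_coveringNumber (K := K) (V := K × L) (N := e + 4) (r := 2)
    (k := 4) (by omega) (by omega) (by simp [hL]; omega)
  have hDψ (W : Submodule K (A × L)) (hW : finrank K W = 2)
      (h : W ≤ LinearMap.range ψ) : ∃ i, W ≤ (D i).map ψ := by
    have hmap := Submodule.map_comap_eq_of_le h
    obtain ⟨i, hi⟩ := hDc (W.comap ψ) (by rw [← finrank_map_of_injective hψ, hmap, hW])
    exact ⟨i, hmap ▸ Submodule.map_mono hi⟩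
  have : Finite A := Module.finite_of_finite K
  let I := {P : Projectivization K A // P ≠ P₀} × Fin (coveringNumber K (e + 3) 3 1)
  have hI : Nat.card I = (Nat.card K + Nat.card K ^ 2 + Nat.card K ^ 3) *
      coveringNumber K (e + 3) 3 1 := by
    have h4 := Projectivization.card_of_finrank K A hA
    have := Fintype.ofFinite (Projectivization K A)
    rw [Nat.card_prod, Nat.card_fin, Nat.card_eq_fintype_card, Fintype.card_subtype_compl,
      Fintype.card_subtype_eq, ← Nat.card_eq_fintype_card, h4]
    simp only [Finset.sum_range_succ, Finset.sum_range_zero]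
    congr 1
    ring_nf
    omega
  have (x : I) : Finite (L ⧸ C x.2) := Quotient.finite _
  have hcard : Nat.card ((L × L) ⊕ (Σ x : I, L ⧸ C x.2) ⊕ Fin (coveringNumber K (e + 4) 4 2)) =
      (Nat.card K ^ (e + 3)) ^ 2 + (Nat.card K + Nat.card K ^ 2 + Nat.card K ^ 3) *
        coveringNumber K (e + 3) 3 1 * Nat.card K ^ e + coveringNumber K (e + 4) 4 2 := by
    rw [Nat.card_sum, Nat.card_sum, Nat.card_prod, Nat.card_fin,
      card_sigma_quotient (K := K) (d := 3) (e := e) (fun x : I => hC x.2) (by omega), hI,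
      Module.natCard_eq_pow_finrank (K := K) (V := L), hL]
    ring
  rw [← hcard]
  refine coveringNumber_le_card (V := A × L) (by simp [hA, hL]; omega)
    (Sum.elim (fun x => (gabidulin φ x.1 x.2).graph)
      (Sum.elim (fun x => cone (C x.1.2) x.1.1.1.rep x.2.out) (fun i => (D i).map ψ))) ?_ ?_
  · rintro (x | x | i)
    · exact (finrank_graph _).trans hA
    · exact (finrank_cone _ (Projectivization.rep_nonzero _) _).trans (by rw [hC])
    · exact (finrank_map_of_injective hψ _).trans (hD i)
  · intro W hW
    rcases finrank_two_trichotomy hW with h | ⟨W', -, rfl⟩ | ⟨a, b, c, ha, rfl⟩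
    · obtain ⟨a, b, hab⟩ := exists_le_graph_gabidulin hφ hW h
      exact ⟨.inl (a, b), hab⟩
    · obtain ⟨i, hi⟩ := hDψ _ hW (by
        rintro _ ⟨y, -, rfl⟩
        exact ⟨(0, y), Prod.ext (zero_smul K _) rfl⟩)
      exact ⟨.inr (.inr i), hi⟩
    · by_cases hP : Projectivization.mk K a ha = P₀
      · obtain ⟨i, hi⟩ := hDψ _ hW (by
          obtain ⟨u, hu⟩ := Projectivization.exists_smul_eq_mk_rep K a ha
          rw [sup_le_iff, Submodule.span_singleton_le_iff_mem,
            Submodule.span_singleton_le_iff_mem]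
          refine ⟨⟨(((u⁻¹ : Kˣ) : K), b), Prod.ext ?_ rfl⟩, ⟨(0, c), Prod.ext (zero_smul K _) rfl⟩⟩
          change ((u⁻¹ : Kˣ) : K) • P₀.rep = a
          rw [← hP, ← hu, ← Units.smul_def, inv_smul_smul])
        exact ⟨.inr (.inr i), hi⟩
      · obtain ⟨i, hi⟩ : ∃ i, c ∈ C i := by
          obtain ⟨d, hd⟩ := exists_ne (0 : L)
          by_cases hc : c = 0
          · obtain ⟨i, -⟩ := hCc (K ∙ d) (finrank_span_singleton hd)
            exact ⟨i, hc ▸ zero_mem _⟩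
          · obtain ⟨i, hi⟩ := hCc (K ∙ c) (finrank_span_singleton hc)
            exact ⟨i, hi (Submodule.mem_span_singleton_self c)⟩
        obtain ⟨x, hx⟩ := exists_le_cone ha b hi
        exact ⟨.inr (.inl ⟨(⟨_, hP⟩, i), x⟩), hx⟩

/-- Taking `A = L` lets the point covering vary with the apex: to `P` belongs the pencil of
hyperplanes of `L` through a line `ℓ P` containing `P`. A line of `0 × L` through `P` and `b` then
lies in the member of that pencil containing `b`, so no further solids are needed. -/
theorem coveringNumber_line_eight (K : Type*) [Field K] [Fintype K] :
    coveringNumber K 8 4 2 ≤ (Nat.card K ^ 4) ^ 2 +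
      (1 + Nat.card K + Nat.card K ^ 2 + Nat.card K ^ 3) * (Nat.card K + 1) * Nat.card K := by
  classical
  obtain ⟨L, _, _, _, hL⟩ := exists_extension_finrank K 4 (by omega)
  have : FiniteDimensional K L := FiniteDimensional.of_finrank_pos (by omega)
  have hℓ (P : Projectivization K L) : ∃ S : Submodule K L, finrank K S = 2 ∧ P.rep ∈ S :=
    exists_finrank_eq_two_mem (by omega) P.rep_nonzero
  choose ℓ hℓ2 hℓP using hℓ
  choose C hC hCc using fun P => exists_pencil (S := ℓ P) (by rw [hℓ2, hL])
  let I := Projectivization K L × Fin (Nat.card K + 1)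
  have hI : Nat.card I = (1 + Nat.card K + Nat.card K ^ 2 + Nat.card K ^ 3) *
      (Nat.card K + 1) := by
    rw [Nat.card_prod, Nat.card_fin, Projectivization.card_of_finrank K L hL]
    simp [Finset.sum_range_succ]
  have (x : I) : Finite (L ⧸ C x.1 x.2) := Quotient.finite _
  have hcard : Nat.card ((L × L) ⊕ (Σ x : I, L ⧸ C x.1 x.2)) =
      (Nat.card K ^ 4) ^ 2 +
      (1 + Nat.card K + Nat.card K ^ 2 + Nat.card K ^ 3) * (Nat.card K + 1) * Nat.card K := by
    rw [Nat.card_sum, Nat.card_prod,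
      card_sigma_quotient (K := K) (d := 3) (e := 1) (fun x : I => by rw [hC, hℓ2]) hL, hI,
      Module.natCard_eq_pow_finrank (K := K) (V := L), hL]
    ring
  rw [← hcard]
  refine coveringNumber_le_card (V := L × L) (by simp [hL])
    (Sum.elim (fun x => (gabidulin LinearMap.id x.1 x.2).graph)
      (fun x => cone (C x.1.1 x.1.2) x.1.1.rep x.2.out)) ?_ ?_
  · rintro (x | x)
    · exact (finrank_graph _).trans hL
    · exact (finrank_cone _ (Projectivization.rep_nonzero _) _).trans (by rw [hC, hℓ2])
  · intro W hW
    rcases finrank_two_trichotomy hW with h | ⟨W', hW', rfl⟩ | ⟨a, b, c, ha, rfl⟩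
    · obtain ⟨a, b, hab⟩ := exists_le_graph_gabidulin (φ := LinearMap.id) Function.injective_id hW h
      exact ⟨.inl (a, b), hab⟩
    · have hne : W' ≠ ⊥ := by
        rintro rfl
        simp at hW'
      obtain ⟨a, haW, ha⟩ := W'.ne_bot_iff.1 hne
      obtain ⟨b, hb, hWb⟩ : ∃ b ∈ W', W' = K ∙ a ⊔ K ∙ b := by
        have hlt : K ∙ a < W' := by
          refine lt_of_le_of_ne (by rwa [Submodule.span_singleton_le_iff_mem]) fun h => ?_
          have := finrank_span_singleton (K := K) ha
          rw [h] at this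
          omega
        obtain ⟨b, hb, hab⟩ := SetLike.exists_of_lt hlt
        refine ⟨b, hb, (Submodule.eq_of_le_of_finrank_eq ?_ ?_).symm⟩
        · rw [sup_le_iff, Submodule.span_singleton_le_iff_mem,
            Submodule.span_singleton_le_iff_mem]
          exact ⟨haW, hb⟩
        · rw [finrank_sup_span_singleton hab, finrank_span_singleton ha, hW']
      set P := Projectivization.mk K a ha with hP
      obtain ⟨u, hu⟩ := Projectivization.exists_smul_eq_mk_rep K a ha
      have haℓ : a ∈ ℓ P := by
        have := (ℓ P).smul_mem ((u⁻¹ : Kˣ) : K) (hℓP P)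
        rwa [hP, ← hu, ← Units.smul_def, inv_smul_smul, ← hP] at this
      obtain ⟨i, hi⟩ := hCc P b
      -- The coset is arbitrary: `W` already lies in the base of the cone.
      refine ⟨.inr ⟨(P, i), 0⟩, ?_⟩
      refine (Submodule.map_mono ?_).trans (le_sup_left (a := (C P i).map _))
      rw [hWb]
      exact (sup_le_sup_right (by rwa [Submodule.span_singleton_le_iff_mem]) _).trans hi
    · obtain ⟨i, hi⟩ := hCc (Projectivization.mk K a ha) c
      obtain ⟨x, hx⟩ := exists_le_cone (K := K) ha b (hi (Submodule.mem_sup_right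
        (Submodule.mem_span_singleton_self c)))
      exact ⟨.inr ⟨(_, i), x⟩, hx⟩

/-! ### The counting lower bound. -/

theorem card_pairs_le_coveringNumber (K : Type*) [Field K] [Fintype K] {N : ℕ} (hN : 4 ≤ N) :
    (Fintype.card K ^ N - 1) * (Fintype.card K ^ N - Fintype.card K) ≤
      coveringNumber K N 4 2 *
        ((Fintype.card K ^ 4 - 1) * (Fintype.card K ^ 4 - Fintype.card K)) := by
  classical
  set V := Fin N → K
  have hV : finrank K V = N := by simp [V]
  obtain ⟨U, hU, hUc⟩ := exists_family_coveringNumber (K := K) (V := V) (k := 4) (r := 2)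
    (by omega) hN hV
  have hpairs := card_linearIndependent (K := K) (V := V) (k := 2) (by omega)
  have hpairsU (i) := card_linearIndependent (K := K) (V := U i) (k := 2) (by rw [hU]; omega)
  simp only [hU, hV, Fin.prod_univ_two, Fin.val_zero, Fin.val_one, pow_zero, pow_one]
    at hpairs hpairsU
  let f : (Σ i, {s : Fin 2 → U i // LinearIndependent K s}) →
      {s : Fin 2 → V // LinearIndependent K s} := fun x =>
    ⟨(U x.1).subtype ∘ x.2.1, x.2.2.map' _ (Submodule.ker_subtype _)⟩
  have hf : Function.Surjective f := by
    rintro ⟨s, hs⟩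
    obtain ⟨i, hi⟩ := hUc (Submodule.span K (Set.range s)) (by
      rw [finrank_span_eq_card hs, Fintype.card_fin])
    let t : Fin 2 → U i := fun j => ⟨s j, hi (Submodule.subset_span ⟨j, rfl⟩)⟩
    exact ⟨⟨i, t, LinearIndependent.of_comp (U i).subtype hs⟩, rfl⟩
  have hle := Nat.card_le_card_of_surjective f hf
  rw [hpairs, Nat.card_sigma, Finset.sum_congr rfl fun i _ => hpairsU i] at hle
  simpa using hle

theorem theta_mul_sub_one {R : Type*} [CommRing R] (m x : ℕ) :
    (theta m x : R) * ((x : R) - 1) = (x : R) ^ (m + 1) - 1 := by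
  simpa [theta] using geom_sum_mul (x : R) (m + 1)

theorem le_coveringNumber_line (K : Type*) [Field K] [Fintype K] {m : ℕ} (hm : 2 ≤ m) :
    (theta (m + 1) (Fintype.card K) : ℚ) * theta m (Fintype.card K) /
      (((Fintype.card K : ℚ) + 1) * ((Fintype.card K : ℚ) ^ 2 + 1) *
        ((Fintype.card K : ℚ) ^ 2 + Fintype.card K + 1)) ≤ coveringNumber K (m + 2) 4 2 := by
  have h := card_pairs_le_coveringNumber K (N := m + 2) (by omega)
  have hq := Fintype.one_lt_card (α := K)
  generalize Fintype.card K = q at h hq ⊢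
  generalize coveringNumber K (m + 2) 4 2 = c at h ⊢
  have h1 : 1 < (q : ℚ) := by exact_mod_cast hq
  have hp (j : ℕ) : 1 ≤ q ^ j := Nat.one_le_pow _ _ (by omega)
  have hp' (j : ℕ) : q ≤ q ^ (j + 1) := Nat.le_self_pow (by omega) q
  have hQ : ((q : ℚ) ^ (m + 2) - 1) * ((q : ℚ) ^ (m + 2) - q) ≤
      c * (((q : ℚ) ^ 4 - 1) * ((q : ℚ) ^ 4 - q)) := by
    have := (Nat.cast_le (α := ℚ)).2 h
    push_cast [Nat.cast_sub (hp _), Nat.cast_sub (hp' (m + 1)), Nat.cast_sub (hp' 3)] at this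
    exact this
  rw [div_le_iff₀ (by positivity)]
  have ht := theta_mul_sub_one (R := ℚ) m q
  have ht' := theta_mul_sub_one (R := ℚ) (m + 1) q
  -- The factor `q(q - 1)^2` turns the theta quotient into the pair count, as `q^4 - 1 = (q - 1)(q +
  -- 1)(q^2 + 1)` and `q^4 - q = q(q - 1)(q^2 + q + 1)`.
  have hpos : 0 < (q : ℚ) * ((q : ℚ) - 1) ^ 2 := by
    have : 0 < (q : ℚ) - 1 := by linarith
    positivity
  refine le_of_mul_le_mul_right ?_ hpos
  calc _ = ((theta (m + 1) q : ℚ) * (q - 1)) * (q * (theta m q * (q - 1))) := by ring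
    _ = ((q : ℚ) ^ (m + 2) - 1) * ((q : ℚ) ^ (m + 2) - q) := by rw [ht, ht']; ring
    _ ≤ _ := hQ
    _ = _ := by ring

/-! ### Solving the recursion for the upper bound. -/

theorem coveringNumber_line_le (K : Type*) [Field K] [Fintype K] (n : ℕ) (q : ℤ)
    (hq : (Nat.card K : ℤ) = q) :
    (coveringNumber K (3 * n + 8) 4 2 : ℤ) ≤
      q ^ (3 * n + 5) * (theta (n + 1) (Nat.card K ^ 3) : ℤ) +
        ∑ i ∈ Finset.range n,
          ((theta (6 * i + 10) (Nat.card K) : ℤ) - (theta (3 * i + 4) (Nat.card K) : ℤ)) +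
        ∑ i ∈ Finset.range (n + 1), q ^ (3 * i + 2) * (2 * q ^ 2 - 1) +
        q * (q + 1) * (2 * q + 1) := by
  induction n with
  | zero =>
    have h := (Nat.cast_le (α := ℤ)).2 (coveringNumber_line_eight K)
    push_cast at h
    rw [hq] at h
    refine h.trans (le_of_eq ?_)
    simp [theta, Finset.sum_range_succ, hq, -Nat.card_eq_fintype_card]
    ring
  | succ n ih =>
    have hq2 : 2 ≤ q := by
      rw [← hq]
      exact_mod_cast Finite.one_lt_card (α := K)
    have hstep := coveringNumber_line_step K (3 * n + 4) (by omega)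
    have hc : (coveringNumber K (3 * n + 7) 3 1 : ℤ) ≤
        q * theta (n + 1) (Nat.card K ^ 3) + 1 := by
      rw [← hq]
      exact_mod_cast coveringNumber_point_le K (n + 1)
    have hT := theta_mul_sub_one (R := ℤ) (n + 1) (Nat.card K ^ 3)
    have hT' : (theta (n + 1 + 1) (Nat.card K ^ 3) : ℤ) =
        theta (n + 1) (Nat.card K ^ 3) + (q ^ 3) ^ (n + 2) := by
      rw [← hq]
      exact_mod_cast Finset.sum_range_succ _ _
    have hθ := theta_mul_sub_one (R := ℤ) (6 * n + 10) (Nat.card K)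
    have hθ' := theta_mul_sub_one (R := ℤ) (3 * n + 4) (Nat.card K)
    rw [Finset.sum_range_succ, Finset.sum_range_succ (n := n + 1), hT']
    have hstepZ := (Nat.cast_le (α := ℤ)).2 hstep
    push_cast at hstepZ hT
    rw [hq] at hstepZ hT hθ hθ'
    generalize (theta (n + 1) (Nat.card K ^ 3) : ℤ) = T at *
    -- Both sides times `q - 1` equal `q^(3n+5) (q^(3n+6) - 1)`; this expresses the new summand
    -- through `T`.
    have hD : (theta (6 * n + 10) (Nat.card K) : ℤ) - theta (3 * n + 4) (Nat.card K) =
        q ^ (3 * n + 5) * T * (q ^ 2 + q + 1) := by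
      refine mul_right_cancel₀ (b := q - 1) (by omega) ?_
      linear_combination hθ - hθ' - q ^ (3 * n + 5) * hT
    rw [hD]
    have hmul : (q + q ^ 2 + q ^ 3) * (coveringNumber K (3 * n + 7) 3 1 : ℤ) * q ^ (3 * n + 4) ≤
        (q + q ^ 2 + q ^ 3) * (q * T + 1) * q ^ (3 * n + 4) := by gcongr
    -- The terms in `T` cancel, and this is exactly the slack between the stated bound and the
    -- recursion; it vanishes for `q = 2`.
    have hrest : 0 ≤ q ^ (3 * n + 5) * ((q - 2) * (q + 1)) :=
      mul_nonneg (by positivity) (mul_nonneg (by omega) (by omega))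
    calc (coveringNumber K (3 * (n + 1) + 8) 4 2 : ℤ) ≤ _ := hstepZ
      _ ≤ (q ^ (3 * n + 7)) ^ 2 + (q + q ^ 2 + q ^ 3) * (q * T + 1) * q ^ (3 * n + 4) + _ :=
        add_le_add (add_le_add_right hmul _) ih
      _ ≤ _ := by
        rw [← sub_nonneg]
        refine hrest.trans (le_of_eq ?_)
        ring

end QCovering

theorem corollary4p6 (K : Type*) [Field K] [Fintype K] (q : ℕ) (hq : Fintype.card K = q)
    (n : ℕ) :
    ⌈((QCovering.theta (3 * n + 7) q : ℚ) * (QCovering.theta (3 * n + 6) q : ℚ)) /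
        (((q : ℚ) + 1) * ((q : ℚ) ^ 2 + 1) * ((q : ℚ) ^ 2 + (q : ℚ) + 1))⌉ ≤
      (QCovering.coveringNumber K (3 * n + 8) 4 2 : ℤ) ∧
    (QCovering.coveringNumber K (3 * n + 8) 4 2 : ℤ) ≤
      (q : ℤ) ^ (3 * n + 5) * (QCovering.theta (n + 1) (q ^ 3) : ℤ) +
        ∑ i ∈ Finset.range n,
          ((QCovering.theta (6 * i + 10) q : ℤ) - (QCovering.theta (3 * i + 4) q : ℤ)) +
        ∑ i ∈ Finset.range (n + 1), (q : ℤ) ^ (3 * i + 2) * (2 * (q : ℤ) ^ 2 - 1) +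
        (q : ℤ) * ((q : ℤ) + 1) * (2 * (q : ℤ) + 1) := by
  have hc : Nat.card K = q := Nat.card_eq_fintype_card.trans hq
  refine ⟨Int.ceil_le.2 ?_, ?_⟩
  · rw [Int.cast_natCast]
    exact hq ▸ QCovering.le_coveringNumber_line K (m := 3 * n + 6) (by omega)
  · exact hc ▸ QCovering.coveringNumber_line_le K n q (by rw [hc])
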